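/- For an abelian group $A$ let $Y^3(A)=\ker\{A\otimes\Lambda^2(A)\to\Lambda^3(A)\}$, the kernel of the multiplication map $a\otimes x\mapsto a\wedge x$, so that $Y^3$ is a (non-additive) endofunctor of the category of abelian groups. For an endofunctor $F$ of abelian groups let $L_iF(A)=\pi_i(FK P_*)$, $i\ge 0$, be its Dold–Puppe derived functors, where $P_*\to A$ is any projective resolution, $K$ is the Dold–Kan functor from non-negatively graded chain complexes to simplicial abelian groups (inverse to Moore normalization), $F$ is applied degreewise, and $\pi_i$ is the $i$-th homology of the Moore normalization. Then, for every projective resolution of $\mathbb Z/3$ used to compute them, there are isomorphisms of abelian groups $$ L_iY^3(\mathbb Z/3)\cong\begin{cases}\mathbb Z/3, & i=2,\\ \mathbb Z/9, & i=1,\\ 0, & i\neq 1,2.\end{cases} $$ -/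

import Mathlib

open CategoryTheory
open scoped TensorProduct

noncomputable section

namespace DoldPuppe

section SchurFunctor

variable (R : Type*) [CommRing R] (A : Type*) [AddCommGroup A] [Module R A]
  {B : Type*} [AddCommGroup B] [Module R B]

/-- The multiplication map `A ⊗ Λᵏ(A) → Λᵏ⁺¹(A)`, `a ⊗ x ↦ a ∧ x`. -/
def wedge (k : ℕ) : A ⊗[R] ⋀[R]^k A →ₗ[R] ⋀[R]^(k + 1) A :=
  TensorProduct.lift
    (LinearMap.mk₂ R
      (fun (a : A) (x : ⋀[R]^k A) =>
        (⟨ExteriorAlgebra.ι R a * (x : ExteriorAlgebra R A), by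
          rw [ExteriorAlgebra.exteriorPower, pow_succ']
          exact Submodule.mul_mem_mul (LinearMap.mem_range_self _ a) x.2⟩ :
          ⋀[R]^(k + 1) A))
      (fun a b x => Subtype.ext (by simp [add_mul]))
      (fun c a x => Subtype.ext (by simp))
      (fun a x y => Subtype.ext (by simp [mul_add]))
      (fun c a x => Subtype.ext (by simp)))

variable {R A}

theorem coe_wedge_tmul (k : ℕ) (a : A) (x : ⋀[R]^k A) :
    (wedge R A k (a ⊗ₜ[R] x) : ExteriorAlgebra R A) = ExteriorAlgebra.ι R a * x := rfl

theorem wedge_tmul_ιMulti (k : ℕ) (a : A) (v : Fin k → A) :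
    wedge R A k (a ⊗ₜ[R] exteriorPower.ιMulti R k v) =
      exteriorPower.ιMulti R (k + 1) (Fin.cons a v) := by
  apply Subtype.ext
  rw [coe_wedge_tmul, exteriorPower.ιMulti_apply_coe, exteriorPower.ιMulti_apply_coe,
    ExteriorAlgebra.ιMulti_apply, ExteriorAlgebra.ιMulti_apply, List.ofFn_succ, List.prod_cons]
  simp only [Fin.cons_zero, Fin.cons_succ]

/-- The multiplication map is natural. -/
theorem wedge_naturality (k : ℕ) (f : A →ₗ[R] B) :
    wedge R B k ∘ₗ TensorProduct.map f (exteriorPower.map k f) =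
      exteriorPower.map (k + 1) f ∘ₗ wedge R A k := by
  ext a v : 4
  change wedge R B k (f a ⊗ₜ[R] exteriorPower.map k f (exteriorPower.ιMulti R k v)) =
    exteriorPower.map (k + 1) f (wedge R A k (a ⊗ₜ[R] exteriorPower.ιMulti R k v))
  rw [exteriorPower.map_apply_ιMulti, wedge_tmul_ιMulti, wedge_tmul_ιMulti,
    exteriorPower.map_apply_ιMulti]
  congr 1
  funext i
  refine Fin.cases ?_ (fun j => ?_) i <;> simp

end SchurFunctor

universe u

/-- The Schur functor `Yᵏ⁺¹`, `Yᵏ⁺¹(A) = ker (A ⊗ Λᵏ(A) → Λᵏ⁺¹(A))`, on modules over a commutative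
ring `R`. For `R = ℤ` it is an endofunctor of the category of abelian groups. -/
def schurY (R : Type u) [CommRing R] (k : ℕ) : ModuleCat.{u} R ⥤ ModuleCat.{u} R where
  obj A := ModuleCat.of R (LinearMap.ker (wedge R A k))
  map {A B} f := ModuleCat.ofHom
    ((TensorProduct.map f.hom (exteriorPower.map k f.hom)).restrict (fun x hx => by
      have h := LinearMap.congr_fun (wedge_naturality k f.hom) x
      simp only [LinearMap.comp_apply] at h
      rw [LinearMap.mem_ker] at hx ⊢
      rw [h, hx, map_zero]))
  map_id A := by
    ext x
    simp
  map_comp f g := by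
    ext x
    simp [TensorProduct.map_comp]

section DerivedFunctor

universe v₁ u₁ v₂ u₂

variable {C : Type u₁} [Category.{v₁} C] [Abelian C] {D : Type u₂} [Category.{v₂} D] [Abelian D]

/-- The homotopy group `πᵢ(X)` of a simplicial object in an abelian category (for instance of a
simplicial abelian group): the `i`-th homology of its Moore normalization. -/
def homotopyGroup (X : SimplicialObject D) (i : ℕ) : D :=
  ((AlgebraicTopology.normalizedMooreComplex D).obj X).homology i

/-- The Dold–Puppe derived functor `LᵢF(A) = πᵢ(F K P)` of a (not necessarily additive) functor
`F`, computed from a projective resolution `P` of `A`. Here `K`, called `Γ` in Mathlib, is the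
Dold–Kan functor, inverse to the Moore normalization; `F` is applied degreewise. -/
def derivedFunctor (F : C ⥤ D) {A : C} (P : ProjectiveResolution A) (i : ℕ) : D :=
  homotopyGroup (((SimplicialObject.whiskering C D).obj F).obj (Abelian.DoldKan.Γ.obj P.complex)) i

end DerivedFunctor

end DoldPuppe

end

/-!
The derived functors of a non-additive functor `F` can be computed from any simplicial object whose
normalization is a projective resolution. By the Dold–Kan correspondence and the homotopy uniqueness
of resolutions, this follows once morphisms of simplicial objects whose normalizations are chain
homotopic are shown to be simplicially homotopic, since simplicial homotopies are preserved by
applying `F` degreewise (`DoldPuppe.nonempty_homotopyGroup_iso`). To prove this, a chain homotopy is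
turned into a chain map on the cylinder `X ⊗ Δ[1]` by composition with the Alexander–Whitney map;
the Dold–Kan correspondence lifts it to a simplicial morphism on the cylinder, and the tautological
homotopy between the two ends of the cylinder does the rest
(`DoldPuppe.nonempty_homotopy_of_normalized`).

For `ℤ/3` the model is the nerve `DoldPuppe.congrNerve 3` of congruence modulo `3`, whose
`n`-simplices are the `(n + 1)`-tuples of congruent integers; its normalization is the resolution
`3ℤ → ℤ`. The tuples have the basis `(1, …, 1), 3e₁, …, 3eₙ`. Every face but the `0`-th pulls the
linear forms dual to this basis back to such forms, and the pullbacks along the `0`-th face are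
`DoldPuppe.congrTuples.form_zero_comp_reindex_zero` and
`DoldPuppe.congrTuples.form_succ_comp_reindex_zero`. Three such forms give a coordinate on
`A ⊗ Λ²(A)`; on the kernel `Y³(A)` these coordinates determine an element, and their cyclic sums
vanish (`DoldPuppe.coord_cyclic`).

In these coordinates the normalization of `Y³` applied to the model is zero in degree `0` and from
degree `4` on, and is a complex `ℤ² → ℤ⁴ → ℤ²` in degrees `3, 2, 1`. With the coordinates
`(1, 2, 3)`, `(2, 1, 3)` in degree `3`, `(0, 1, 2)`, `(1, 0, 2)`, `(1, 1, 2)`, `(2, 1, 2)` in degree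
`2` and `(0, 0, 1)`, `(1, 0, 1)` in degree `1`, the differentials are
`(u, v) ↦ (3u, 3v, -u - v, v - 2u)` and `(a, b, c, d) ↦ (3a + 3b + 9c, a - 2b - 3c + 3d)`.
The first one is injective, the cokernel of the second one is `ℤ/9` by `(p, q) ↦ p + 6q`, and the
homology in the middle is `ℤ/3` by `(a, b, c, d) ↦ a`.
-/

noncomputable section

open CategoryTheory Limits Simplicial Opposite AlgebraicTopology SSet

namespace DoldPuppe

universe v₁ u₁ v₂ u₂

/-! ### The cylinder on a simplicial object and chain homotopies -/

section Cylinder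

variable {C : Type u₁} [Category.{v₁} C] [HasFiniteCoproducts C]

/-- The cylinder `X ⊗ Δ[1]` on a simplicial object: in degree `Δ` it is the coproduct of copies of
`X.obj Δ` indexed by the `Δ`-simplices of `Δ[1]`. -/
def cylinder (X : SimplicialObject C) : SimplicialObject C where
  obj Δ := ∐ fun _ : (Δ[1] : SSet.{0}).obj Δ => X.obj Δ
  map {Δ Δ'} θ := Sigma.desc fun α =>
    X.map θ ≫ Sigma.ι (fun _ : (Δ[1] : SSet.{0}).obj Δ' => X.obj Δ') ((Δ[1] : SSet.{0}).map θ α)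
  map_id Δ := by
    apply Sigma.hom_ext
    intro α
    simp
  map_comp θ θ' := by
    apply Sigma.hom_ext
    intro α
    simp

namespace cylinder

variable (X : SimplicialObject C)

/-- The inclusion of the copy of `X.obj Δ` labelled by the simplex `α` of `Δ[1]`. -/
def ι {Δ : SimplexCategoryᵒᵖ} (α : (Δ[1] : SSet.{0}).obj Δ) : X.obj Δ ⟶ (cylinder X).obj Δ :=
  Sigma.ι (fun _ : (Δ[1] : SSet.{0}).obj Δ => X.obj Δ) α

variable {X}

lemma hom_ext {Δ : SimplexCategoryᵒᵖ} {Z : C} {f g : (cylinder X).obj Δ ⟶ Z}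
    (h : ∀ α, ι X α ≫ f = ι X α ≫ g) : f = g :=
  Sigma.hom_ext _ _ h

/-- The morphism out of a term of the cylinder with prescribed components. -/
def desc {Δ : SimplexCategoryᵒᵖ} {Z : C} (f : (Δ[1] : SSet.{0}).obj Δ → (X.obj Δ ⟶ Z)) :
    (cylinder X).obj Δ ⟶ Z :=
  Sigma.desc f

@[simp]
lemma ι_desc {Δ : SimplexCategoryᵒᵖ} {Z : C} (f : (Δ[1] : SSet.{0}).obj Δ → (X.obj Δ ⟶ Z)) (α) :
    ι X α ≫ desc f = f α := by
  exact Sigma.ι_desc _ _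

lemma ι_map {Δ Δ' : SimplexCategoryᵒᵖ} (θ : Δ ⟶ Δ') (α : (Δ[1] : SSet.{0}).obj Δ) :
    ι X α ≫ (cylinder X).map θ = X.map θ ≫ ι X ((Δ[1] : SSet.{0}).map θ α) := by
  simp [ι, cylinder]

lemma ι_δ {n : ℕ} (i : Fin (n + 2)) (α : (Δ[1] : SSet.{0}) _⦋n + 1⦌) :
    ι X α ≫ (cylinder X).δ i = X.δ i ≫ ι X ((Δ[1] : SSet.{0}).δ i α) :=
  ι_map _ _

lemma ι_σ {n : ℕ} (i : Fin (n + 1)) (α : (Δ[1] : SSet.{0}) _⦋n⦌) :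
    ι X α ≫ (cylinder X).σ i = X.σ i ≫ ι X ((Δ[1] : SSet.{0}).σ i α) :=
  ι_map _ _

/-- The end of the cylinder over the vertex `0` of `Δ[1]`. -/
def i₀ : X ⟶ cylinder X where
  app Δ := ι X (stdSimplex.const 1 0 Δ)
  naturality Δ Δ' θ := by
    rw [ι_map]; rfl

/-- The end of the cylinder over the vertex `1` of `Δ[1]`. -/
def i₁ : X ⟶ cylinder X where
  app Δ := ι X (stdSimplex.const 1 1 Δ)
  naturality Δ Δ' θ := by
    rw [ι_map]; rfl

variable (X) in
/-- The inclusion of the copy of `X _⦋n⦌` labelled by the simplex of `Δ[1]` that takes `k` times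
the value `0`. -/
def ιMk {n : ℕ} (k : Fin (n + 2)) : X _⦋n⦌ ⟶ (cylinder X) _⦋n⦌ :=
  ι X (stdSimplex.objMk₁.{0} k)

lemma ιMk_castSucc_δ {n : ℕ} (k j : Fin (n + 2)) (h : k ≤ j) :
    ιMk X k.castSucc ≫ (cylinder X).δ j = X.δ j ≫ ιMk X k := by
  rw [ιMk, ι_δ, stdSimplex.δ_objMk₁_of_le _ _ (by simpa using h)]
  rfl

lemma ιMk_succ_δ {n : ℕ} (k j : Fin (n + 2)) (h : j ≤ k) :
    ιMk X k.succ ≫ (cylinder X).δ j = X.δ j ≫ ιMk X k := by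
  rw [ιMk, ι_δ, stdSimplex.δ_objMk₁_of_lt _ _ (by simpa [Fin.castSucc_lt_succ_iff] using h)]
  rfl

lemma ιMk_σ_of_le {n : ℕ} (k : Fin (n + 2)) (j : Fin (n + 1)) (h : k ≤ j.castSucc) :
    ιMk X k ≫ (cylinder X).σ j = X.σ j ≫ ιMk X k.castSucc := by
  rw [ιMk, ι_σ, stdSimplex.σ_objMk₁_of_le _ _ h]
  rfl

lemma ιMk_σ_of_lt {n : ℕ} (k : Fin (n + 2)) (j : Fin (n + 1)) (h : j.castSucc < k) :
    ιMk X k ≫ (cylinder X).σ j = X.σ j ≫ ιMk X k.succ := by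
  rw [ιMk, ι_σ, stdSimplex.σ_objMk₁_of_lt _ _ h]
  rfl

@[simp]
lemma i₀_app (n : ℕ) : (i₀ (X := X)).app (op ⦋n⦌) = ιMk X (Fin.last (n + 1)) := by
  have : stdSimplex.const.{0} 1 0 (op ⦋n⦌) = stdSimplex.objMk₁.{0} (Fin.last (n + 1)) := by
    ext k : 1
    exact (stdSimplex.objMk₁_of_castSucc_lt.{0} _ _ (Fin.castSucc_lt_last k)).symm
  rw [ιMk, ← this]
  rfl

@[simp]
lemma i₁_app (n : ℕ) : (i₁ (X := X)).app (op ⦋n⦌) = ιMk X 0 := by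
  have : stdSimplex.const.{0} 1 1 (op ⦋n⦌) = stdSimplex.objMk₁.{0} 0 := by
    ext k : 1
    exact (stdSimplex.objMk₁_of_le_castSucc.{0} _ _ (Fin.zero_le _)).symm
  rw [ιMk, ← this]
  rfl

/-- The tautological simplicial homotopy between the two ends of the cylinder. -/
def homotopy (X : SimplicialObject C) : SimplicialObject.Homotopy (i₀ (X := X)) i₁ where
  h i := X.σ i ≫ ιMk X i.succ.castSucc
  h_zero_comp_δ_zero n := by
    rw [i₁_app, Category.assoc, ← Fin.succ_castSucc, ιMk_succ_δ _ _ (by simp),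
      X.δ_comp_σ_self'_assoc (by simp)]
    rfl
  h_last_comp_δ_last n := by
    rw [i₀_app, Category.assoc, ιMk_castSucc_δ _ _ (by simp), X.δ_comp_σ_succ'_assoc (by simp)]
    rfl
  h_succ_comp_δ_castSucc_of_lt {n} i j hij := by
    rw [Category.assoc, ← Fin.succ_castSucc, ιMk_succ_δ _ _ (by grind),
      X.δ_comp_σ_of_le_assoc hij]
  h_succ_comp_δ_castSucc_succ {n} j := by
    rw [Category.assoc, Category.assoc, ← Fin.succ_castSucc j.succ, ιMk_succ_δ _ _ (by grind),
      ιMk_castSucc_δ _ _ (by grind), X.δ_comp_σ_self'_assoc (by simp),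
      X.δ_comp_σ_succ'_assoc (by simp)]
    rfl
  h_castSucc_comp_δ_succ_of_lt {n} i j hij := by
    rw [Category.assoc, ιMk_castSucc_δ _ _ (by grind), X.δ_comp_σ_of_gt_assoc hij]
    rfl
  h_comp_σ_castSucc_of_le {n} i j hij := by
    rw [Category.assoc, ιMk_σ_of_lt _ _ (by grind), X.σ_comp_σ_assoc hij]
    rfl
  h_comp_σ_succ_of_lt {n} i j hij := by
    rw [Category.assoc, ιMk_σ_of_le _ _ (by grind), ← X.σ_comp_σ_assoc hij]
    rfl

end cylinder
end Cylinder

section ChainHomotopy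

variable {C : Type u₁} [Category.{v₁} C] [Abelian C] {X : SimplicialObject C} {D : ChainComplex C ℕ}
  {f g : (alternatingFaceMapComplex C).obj X ⟶ D} (h : Homotopy f g)

namespace cylinder

/-- The component at `X _⦋n⦌` of the Alexander–Whitney correction term: the homotopy applied to the
front face, up to sign. -/
def corr (h : Homotopy f g) : (n : ℕ) → (((alternatingFaceMapComplex C).obj X).X n ⟶ D.X n) :=
  fun n => match n with
  | 0 => 0
  | n + 1 => (-1 : ℤ) ^ (n + 1) • (X.δ (Fin.last (n + 1)) ≫ h.hom n (n + 1))

/-- The value on the copy of `X _⦋n⦌` labelled by `objMk₁ k` of the chain map associated with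
a chain homotopy. -/
def component (h : Homotopy f g) (n k : ℕ) :
    ((alternatingFaceMapComplex C).obj X).X n ⟶ D.X n :=
  if k = n + 1 then f.f n else if k = n then g.f n + corr h n else g.f n

lemma sum_comp_map (φ : (alternatingFaceMapComplex C).obj X ⟶ D) (n : ℕ) :
    ∑ i : Fin (n + 2), (-1 : ℤ) ^ (i : ℕ) • X.δ i ≫ φ.f n = φ.f (n + 1) ≫ D.d (n + 1) n := by
  rw [φ.comm, alternatingFaceMapComplex_obj_d, AlternatingFaceMapComplex.objD,
    Preadditive.sum_comp]
  simp

/-- The relation defining a chain homotopy, composed with the last face. -/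
lemma sum_comp_corr (n : ℕ) :
    ∑ i : Fin (n + 1), (-1 : ℤ) ^ (i : ℕ) • X.δ i.castSucc ≫ corr h n +
      (-1 : ℤ) ^ (n + 1) • X.δ (Fin.last (n + 1)) ≫ (f.f n - g.f n) =
    corr h (n + 1) ≫ D.d (n + 1) n := by
  have hc := h.comm n
  cases n with
  | zero =>
    rw [dNext_eq_zero _ _ (by simp), zero_add, prevD_eq _ (j' := 1) (by simp)] at hc
    simp [corr, hc]
  | succ n =>
    rw [dNext_eq _ (i' := n) (by simp), prevD_eq _ (j' := n + 2) (by simp),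
      alternatingFaceMapComplex_obj_d, AlternatingFaceMapComplex.objD] at hc
    have hδ (i : Fin (n + 2)) :
        X.δ i.castSucc ≫ X.δ (Fin.last (n + 1)) = X.δ (Fin.last (n + 2)) ≫ X.δ i :=
      (X.δ_comp_δ (Fin.le_last i)).symm
    simp only [corr, Preadditive.comp_zsmul, Preadditive.zsmul_comp, reassoc_of% hδ, hc,
      add_sub_cancel_right, Preadditive.comp_add, Preadditive.comp_sum, Preadditive.sum_comp,
      Category.assoc, smul_add, Finset.smul_sum, smul_smul]
    rw [← add_assoc, ← Finset.sum_add_distrib, add_eq_right]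
    refine Finset.sum_eq_zero fun i _ => ?_
    rw [← add_smul, pow_succ (-1 : ℤ) (n + 1)]
    simp [mul_comm]

lemma component_add_one (n : ℕ) : component h n (n + 1) = f.f n := by
  simp [component]

lemma component_self (n : ℕ) : component h n n = g.f n + corr h n := by
  simp [component]

lemma component_of_lt {n k : ℕ} (hk : k < n) : component h n k = g.f n := by
  simp [component, hk.ne, (hk.trans n.lt_succ_self).ne]

/-- The last two faces of the correction term agree, by the simplicial identities. -/
lemma δ_comp_corr (n : ℕ) :
    X.δ (Fin.last n).castSucc ≫ corr h n = X.δ (Fin.last (n + 1)) ≫ corr h n := by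
  cases n with
  | zero => simp [corr]
  | succ n =>
    have := X.δ_comp_δ_self_assoc (i := Fin.last (n + 1)) (h.hom n (n + 1))
    simp only [corr, Preadditive.comp_zsmul]
    exact congrArg _ this

/-- The compatibility of the components with the differentials: the `i`-th face maps the copy of
`X _⦋n + 1⦌` labelled by `objMk₁ k` to the one labelled by `objMk₁ k` if `k ≤ i`, and to the one
labelled by `objMk₁ (k - 1)` otherwise. -/
lemma component_comm (n k : ℕ) (hk : k ≤ n + 2) :
    component h (n + 1) k ≫ D.d (n + 1) n =
      ∑ i : Fin (n + 2), (-1 : ℤ) ^ (i : ℕ) • X.δ i ≫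
        component h n (if k ≤ i then k else k - 1) := by
  obtain rfl | rfl | rfl | hk : k = n + 2 ∨ k = n + 1 ∨ k = n ∨ k < n := by lia
  · have (i : Fin (n + 2)) : ¬ n + 2 ≤ (i : ℕ) := by lia
    simp only [this, if_false, component_add_one, ← sum_comp_map]
    simp [component_add_one]
  · have (i : Fin (n + 1)) : ¬ n + 1 ≤ (i : ℕ) := by lia
    rw [component_self, Preadditive.add_comp, ← sum_comp_map, ← sum_comp_corr]
    simp only [Fin.sum_univ_castSucc (n := n + 1), Fin.val_castSucc, this, Fin.val_last, if_false,
      le_refl, if_true, component_add_one, Nat.add_sub_cancel, component_self,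
      Preadditive.comp_add, Preadditive.comp_sub, smul_add, smul_sub, Finset.sum_add_distrib]
    abel
  · have (i : Fin k) :
        component h k (if k ≤ (i : ℕ) then k else k - 1) = g.f k := by
      rw [if_neg (by lia), component_of_lt h (Nat.sub_one_lt i.pos.ne')]
    rw [component_of_lt h (by lia), ← sum_comp_map, Fin.sum_univ_castSucc, Fin.sum_univ_castSucc,
      Fin.sum_univ_castSucc, Fin.sum_univ_castSucc]
    simp only [Fin.val_castSucc, Fin.val_last, this, le_refl, if_true, Nat.le_succ,
      component_self, Preadditive.comp_add, smul_add, δ_comp_corr, pow_succ, mul_neg, mul_one,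
      neg_smul]
    abel
  · have (i : Fin (n + 2)) :
        component h n (if k ≤ (i : ℕ) then k else k - 1) = g.f n :=
      component_of_lt h (by split_ifs <;> lia)
    simp only [this, component_of_lt h (hk.trans n.lt_succ_self), sum_comp_map]

/-- The components of `ofHomotopy`. -/
def ofHomotopyF (n : ℕ) : (cylinder X) _⦋n⦌ ⟶ D.X n :=
  desc fun α => component h n
    ((Equiv.ofBijective _ (stdSimplex.objMk₁_bijective.{0} (n := n))).symm α : Fin (n + 2))

@[simp]
lemma ιMk_ofHomotopyF {n : ℕ} (k : Fin (n + 2)) :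
    ιMk X k ≫ ofHomotopyF h n = component h n k := by
  rw [ofHomotopyF, ιMk, ι_desc]
  congr
  exact Equiv.ofBijective_symm_apply_apply _ _ _

lemma hom_ext' {n : ℕ} {Z : C} {f g : (cylinder X) _⦋n⦌ ⟶ Z}
    (H : ∀ k, ιMk X k ≫ f = ιMk X k ≫ g) : f = g := by
  refine hom_ext fun α => ?_
  obtain ⟨k, rfl⟩ := stdSimplex.objMk₁_surjective α
  exact H k

lemma ιMk_δ_ofHomotopyF (n : ℕ) (k : Fin (n + 3)) (i : Fin (n + 2)) :
    ιMk X k ≫ (cylinder X).δ i ≫ ofHomotopyF h n =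
      X.δ i ≫ component h n (if (k : ℕ) ≤ i then k else k - 1) := by
  split_ifs with hk
  · obtain ⟨k, rfl⟩ := Fin.exists_castSucc_eq.2 (show k ≠ Fin.last _ by grind)
    rw [← Category.assoc, ιMk_castSucc_δ _ _ (by simpa using hk), Category.assoc,
      ιMk_ofHomotopyF, Fin.val_castSucc]
  · obtain ⟨k, rfl⟩ := Fin.exists_succ_eq.2 (show k ≠ 0 by grind)
    rw [← Category.assoc, ιMk_succ_δ _ _ (by grind), Category.assoc, ιMk_ofHomotopyF, Fin.val_succ,
      Nat.add_sub_cancel]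

/-- The chain map on the cylinder which corresponds to a chain homotopy under the
Alexander–Whitney map. -/
def ofHomotopy : (alternatingFaceMapComplex C).obj (cylinder X) ⟶ D where
  f n := ofHomotopyF h n
  comm' := by
    rintro _ n rfl
    refine hom_ext' fun k => ?_
    rw [← Category.assoc, ιMk_ofHomotopyF, component_comm h n k (by lia),
      alternatingFaceMapComplex_obj_d, AlternatingFaceMapComplex.objD,
      Preadditive.sum_comp, Preadditive.comp_sum]
    refine Finset.sum_congr rfl fun i _ => ?_
    rw [Preadditive.zsmul_comp, Preadditive.comp_zsmul, ιMk_δ_ofHomotopyF]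

lemma i₀_ofHomotopy : (alternatingFaceMapComplex C).map i₀ ≫ ofHomotopy h = f := by
  ext n
  simp [ofHomotopy, component]

lemma i₁_ofHomotopy : (alternatingFaceMapComplex C).map i₁ ≫ ofHomotopy h = g := by
  ext n
  cases n <;> simp [ofHomotopy, component, corr]

end cylinder

instance : (normalizedMooreComplex C).IsEquivalence :=
  inferInstanceAs (Abelian.DoldKan.equivalence (A := C)).functor.IsEquivalence

/-- Morphisms of simplicial objects that become chain homotopic after normalization are
simplicially homotopic. -/
lemma nonempty_homotopy_of_normalized {X Y : SimplicialObject C} {f g : X ⟶ Y}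
    (h : Homotopy ((normalizedMooreComplex C).map f) ((normalizedMooreComplex C).map g)) :
    Nonempty (SimplicialObject.Homotopy f g) := by
  let p : (alternatingFaceMapComplex C).obj X ⟶ (normalizedMooreComplex C).obj X :=
    DoldKan.PInftyToNormalizedMooreComplex X
  let ψ := cylinder.ofHomotopy (h.compLeft p)
  obtain ⟨Ψ, hΨ⟩ := (normalizedMooreComplex C).map_surjective
    (inclusionOfMooreComplexMap (cylinder X) ≫ ψ)
  -- Normalization is faithful, and `p` is a retraction of the inclusion of the normalization.
  have hN {k : X ⟶ cylinder X} {f : X ⟶ Y}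
      (hk : (alternatingFaceMapComplex C).map k ≫ ψ = p ≫ (normalizedMooreComplex C).map f) :
      k ≫ Ψ = f := by
    apply (normalizedMooreComplex C).map_injective
    rw [Functor.map_comp, hΨ]
    have hk' : (normalizedMooreComplex C).map k ≫ inclusionOfMooreComplexMap _ =
      inclusionOfMooreComplexMap _ ≫ (alternatingFaceMapComplex C).map k :=
      (inclusionOfMooreComplex C).naturality k
    have hp : inclusionOfMooreComplexMap X ≫ p = 𝟙 _ :=
      (DoldKan.splitMonoInclusionOfMooreComplexMap X).id
    rw [reassoc_of% hk', hk, reassoc_of% hp]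
  have h₀ : cylinder.i₀ ≫ Ψ = f := hN (cylinder.i₀_ofHomotopy _)
  have h₁ : cylinder.i₁ ≫ Ψ = g := hN (cylinder.i₁_ofHomotopy _)
  exact ⟨h₀ ▸ h₁ ▸ (cylinder.homotopy X).postcomp Ψ⟩

end ChainHomotopy

/-! ### Invariance of derived functors and homotopy groups of simplicial modules -/

section Invariance

variable {C : Type u₁} [Category.{v₁} C] [Abelian C] {D : Type u₂} [Category.{v₂} D] [Abelian D]

/-- The homotopy groups of `F X` depend only on the chain homotopy type of the normalization of
`X`, even when `F` is not additive. -/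
lemma nonempty_homotopyGroup_iso (F : C ⥤ D) {X Y : SimplicialObject C}
    (e : HomotopyEquiv ((normalizedMooreComplex C).obj X) ((normalizedMooreComplex C).obj Y))
    (i : ℕ) :
    Nonempty (homotopyGroup (((SimplicialObject.whiskering C D).obj F).obj X) i ≅
      homotopyGroup (((SimplicialObject.whiskering C D).obj F).obj Y) i) := by
  obtain ⟨a, ha⟩ := (normalizedMooreComplex C).map_surjective e.hom
  obtain ⟨b, hb⟩ := (normalizedMooreComplex C).map_surjective e.inv
  obtain ⟨hab⟩ := nonempty_homotopy_of_normalized (f := a ≫ b) (g := 𝟙 X)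
    ((Homotopy.ofEq (by rw [Functor.map_comp, ha, hb])).trans
      (e.homotopyHomInvId.trans (Homotopy.ofEq (CategoryTheory.Functor.map_id _ _).symm)))
  obtain ⟨hba⟩ := nonempty_homotopy_of_normalized (f := b ≫ a) (g := 𝟙 Y)
    ((Homotopy.ofEq (by rw [Functor.map_comp, ha, hb])).trans
      (e.homotopyInvHomId.trans (Homotopy.ofEq (CategoryTheory.Functor.map_id _ _).symm)))
  let W := (SimplicialObject.whiskering C D).obj F
  let H := alternatingFaceMapComplex D ⋙ HomologicalComplex.homologyFunctor D _ i
  have h₁ : H.map (W.map a) ≫ H.map (W.map b) = 𝟙 _ := by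
    rw [← H.map_comp, ← W.map_comp, ← H.map_id, ← W.map_id]
    exact (hab.whiskerRight F).map_homology_eq i
  have h₂ : H.map (W.map b) ≫ H.map (W.map a) = 𝟙 _ := by
    rw [← H.map_comp, ← W.map_comp, ← H.map_id, ← W.map_id]
    exact (hba.whiskerRight F).map_homology_eq i
  let κ (Z : SimplicialObject D) : homotopyGroup Z i ≅ H.obj Z :=
    DoldKan.homotopyEquivNormalizedMooreComplexAlternatingFaceMapComplex.toHomologyIso i
  exact ⟨κ _ ≪≫ ⟨_, _, h₁, h₂⟩ ≪≫ (κ _).symm⟩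

/-- Any simplicial object whose normalization is a projective resolution of `A` can be used to
compute the derived functors at `A`. -/
lemma nonempty_derivedFunctor_iso (F : C ⥤ D) {A : C} (P Q : ProjectiveResolution A)
    {X : SimplicialObject C} (e : (normalizedMooreComplex C).obj X ≅ Q.complex) (i : ℕ) :
    Nonempty (derivedFunctor F P i ≅
      homotopyGroup (((SimplicialObject.whiskering C D).obj F).obj X) i) := by
  let ε : (normalizedMooreComplex C).obj (Abelian.DoldKan.Γ.obj P.complex) ≅ P.complex :=
    (Abelian.DoldKan.equivalence (A := C)).counitIso.app P.complex
  exact nonempty_homotopyGroup_iso F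
    ((HomotopyEquiv.ofIso ε).trans ((ProjectiveResolution.homotopyEquiv P Q).trans
      (HomotopyEquiv.ofIso e.symm))) i

end Invariance

section Elements

variable {R : Type u₁} [Ring R]

lemma range_arrow_objX (S : SimplicialObject (ModuleCat.{v₁} R)) (n : ℕ) (x : S _⦋n + 1⦌) :
    x ∈ LinearMap.range (NormalizedMooreComplex.objX S (n + 1)).arrow.hom ↔
      ∀ i : Fin (n + 1), S.δ i.succ x = 0 := by
  constructor
  · rintro ⟨y, rfl⟩ i
    have := DoldKan.HigherFacesVanish.inclusionOfMooreComplexMap (X := S) n i (by lia)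
    rw [inclusionOfMooreComplexMap_f] at this
    exact ConcreteCategory.congr_hom this y
  · intro h
    let K : Submodule R (S _⦋n + 1⦌) := ⨅ i : Fin (n + 1), LinearMap.ker (S.δ i.succ).hom
    let κ : ModuleCat.of R K ⟶ S _⦋n + 1⦌ := ModuleCat.ofHom K.subtype
    have hκ : (NormalizedMooreComplex.objX S (n + 1)).Factors κ :=
      (Subobject.finset_inf_factors _).2 fun i _ =>
        kernelSubobject_factors _ _ (by
          ext ⟨z, hz⟩
          exact (Submodule.mem_iInf _).1 hz i)
    refine ⟨Subobject.factorThru _ κ hκ ⟨x, (Submodule.mem_iInf _).2 h⟩, ?_⟩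
    exact ConcreteCategory.congr_hom (Subobject.factorThru_arrow _ κ hκ) _

lemma injective_arrow (S : SimplicialObject (ModuleCat.{v₁} R)) (n : ℕ) :
    Function.Injective (NormalizedMooreComplex.objX S n).arrow :=
  (ModuleCat.mono_iff_injective _).1 inferInstance

lemma arrow_d (S : SimplicialObject (ModuleCat.{v₁} R)) (n : ℕ)
    (x : ((normalizedMooreComplex _).obj S).X (n + 1)) :
    (NormalizedMooreComplex.objX S n).arrow (((normalizedMooreComplex _).obj S).d (n + 1) n x) =
      S.δ 0 ((NormalizedMooreComplex.objX S (n + 1)).arrow x) := by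
  refine Eq.trans ?_ (ConcreteCategory.congr_hom (show
    ((normalizedMooreComplex _).obj S).d (n + 1) n ≫ (NormalizedMooreComplex.objX S n).arrow =
      (NormalizedMooreComplex.objX S (n + 1)).arrow ≫ S.δ 0 by
    rw [normalizedMooreComplex_objD]
    cases n with
    | zero =>
      refine (Category.assoc _ _ _).trans (congrArg _ ((Category.assoc _ _ _).trans ?_))
      exact (congrArg _ (IsIso.inv_hom_id (⊤ : Subobject (S _⦋0⦌)).arrow)).trans
        (Category.comp_id _)
    | succ n =>
      rw [NormalizedMooreComplex.objD]
      exact Subobject.factorThru_arrow _ _ _) x)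
  rfl

/-- In positive degrees the homotopy groups of a simplicial module are the simplices with trivial
boundary modulo the `0`-th faces of the simplices whose other faces vanish. The description is given
through a linear map `φ` which identifies the quotient with `Q`. -/
lemma nonempty_homotopyGroup_linearEquiv (S : SimplicialObject (ModuleCat.{v₁} R)) (n : ℕ)
    {Q : Type*} [AddCommGroup Q] [Module R Q] (φ : S _⦋n + 1⦌ →ₗ[R] Q)
    (hφ : ∀ q, ∃ x, (∀ i, S.δ i x = 0) ∧ φ x = q)
    (hker : ∀ x, (∀ i, S.δ i x = 0) →
      (φ x = 0 ↔ ∃ y : S _⦋n + 2⦌, (∀ i : Fin (n + 2), S.δ i.succ y = 0) ∧ S.δ 0 y = x)) :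
    Nonempty ((homotopyGroup S (n + 1) : ModuleCat R) ≃ₗ[R] Q) := by
  let K := (normalizedMooreComplex (ModuleCat.{v₁} R)).obj S
  let T := K.sc' (n + 2) (n + 1) n
  let a (m : ℕ) : K.X m ⟶ S _⦋m⦌ := (NormalizedMooreComplex.objX S m).arrow
  have ha (m : ℕ) : Function.Injective (a m) := injective_arrow S m
  have hcyc (x : K.X (n + 1)) : K.d (n + 1) n x = 0 ↔ ∀ i, S.δ i (a (n + 1) x) = 0 := by
    have hd : a n (K.d (n + 1) n x) = S.δ 0 (a (n + 1) x) := arrow_d S n x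
    rw [Fin.forall_fin_succ, ← hd, map_eq_zero_iff _ (ha n)]
    exact (and_iff_left ((range_arrow_objX S n _).1 ⟨x, rfl⟩)).symm
  let ψ : LinearMap.ker T.g.hom →ₗ[R] Q := φ ∘ₗ (a (n + 1)).hom ∘ₗ Submodule.subtype _
  have hψ : Function.Surjective ψ := by
    intro q
    obtain ⟨x, hx, rfl⟩ := hφ q
    obtain ⟨x, rfl⟩ := (range_arrow_objX S n x).2 fun i => hx _
    exact ⟨⟨x, (hcyc x).2 hx⟩, rfl⟩
  have hψ' : LinearMap.range T.moduleCatToCycles = LinearMap.ker ψ := by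
    ext ⟨x, hx⟩
    rw [LinearMap.mem_ker]
    refine Iff.trans ?_ (hker _ ((hcyc x).1 hx)).symm
    constructor
    · rintro ⟨y, hy⟩
      refine ⟨a (n + 2) y, (range_arrow_objX S _ _).1 ⟨y, rfl⟩, ?_⟩
      exact (arrow_d S (n + 1) y).symm.trans (congrArg (a (n + 1)) (congrArg Subtype.val hy))
    · rintro ⟨y, hy, hy'⟩
      obtain ⟨y, rfl⟩ := (range_arrow_objX S _ y).2 hy
      refine ⟨y, Subtype.ext (injective_arrow S _ ?_)⟩
      exact (arrow_d S (n + 1) y).trans hy'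
  exact ⟨((ShortComplex.homologyMapIso (K.isoSc' (n + 2) (n + 1) n (by simp) (by simp))) ≪≫
    T.moduleCatHomologyIso).toLinearEquiv ≪≫ₗ Submodule.quotEquivOfEq _ _ hψ' ≪≫ₗ
      ψ.quotKerEquivOfSurjective hψ⟩

end Elements

/-! ### A simplicial resolution of a cyclic group -/

section Resolution

/-- The integral tuples whose entries are all congruent modulo `N`. -/
def congrTuples (N : ℕ) (ι : Type) : Submodule ℤ (ι → ℤ) where
  carrier := {m | ∀ i j, (N : ℤ) ∣ m i - m j}
  zero_mem' i j := by simp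
  add_mem' {a b} ha hb i j := by
    simpa [add_sub_add_comm] using dvd_add (ha i j) (hb i j)
  smul_mem' c a ha i j := by
    simpa [← mul_sub] using (ha i j).mul_left c

/-- Reindexing of tuples of congruent integers. -/
def congrTuples.reindex (N : ℕ) {ι κ : Type} (f : κ → ι) : congrTuples N ι →ₗ[ℤ] congrTuples N κ :=
  (LinearMap.funLeft ℤ ℤ f).restrict fun _ hm i j => hm (f i) (f j)

/-- The simplicial abelian group whose `n`-simplices are the `(n + 1)`-tuples of integers that are
all congruent modulo `N`. It is the nerve of the congruence relation, and its normalization is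
concentrated in degrees `0` and `1`, where it is the inclusion `Nℤ → ℤ`. -/
def congrNerve (N : ℕ) : SimplicialObject (ModuleCat.{0} ℤ) where
  obj Δ := ModuleCat.of ℤ (congrTuples N (Fin (Δ.unop.len + 1)))
  map θ := ModuleCat.ofHom (congrTuples.reindex N θ.unop.toOrderHom)

/-- A tuple of length at least two all of whose faces vanish is zero, since every entry occurs in
some face. -/
lemma congrNerve_eq_zero {N n : ℕ} {m : (congrNerve N) _⦋n + 1⦌}
    (hm : ∀ i, (congrNerve N).δ i m = 0) : m = 0 := by
  refine Subtype.ext (funext fun j => ?_)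
  obtain ⟨i, hi⟩ := exists_ne j
  obtain ⟨k, rfl⟩ := Fin.exists_succAbove_eq hi.symm
  exact congrFun (congrArg Subtype.val (hm i)) k

instance (N n : ℕ) : Projective (((normalizedMooreComplex _).obj (congrNerve N)).X n) := by
  let e := LinearEquiv.ofInjective _ (injective_arrow (congrNerve N) n)
  have : Module.Free ℤ (congrNerve N _⦋n⦌) :=
    inferInstanceAs (Module.Free ℤ (congrTuples N (Fin (n + 1))))
  have : Module.Finite ℤ (congrNerve N _⦋n⦌) :=
    inferInstanceAs (Module.Finite ℤ (congrTuples N (Fin (n + 1))))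
  have : Module.Free ℤ (((normalizedMooreComplex _).obj (congrNerve N)).X n) :=
    Module.Free.of_equiv e.symm
  exact (IsProjective.iff_projective _).1
    (inferInstanceAs (Module.Projective ℤ (((normalizedMooreComplex _).obj (congrNerve N)).X n)))

/-- The augmentation of `congrNerve N`. -/
def congrNerve.augmentation (N : ℕ) : (congrNerve N) _⦋0⦌ ⟶ ModuleCat.of ℤ (ZMod N) :=
  ModuleCat.ofHom ((Int.castAddHom (ZMod N)).toIntLinearMap ∘ₗ LinearMap.proj (0 : Fin 1) ∘ₗ
    (congrTuples N (Fin 1)).subtype)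

/-- The augmentation of the normalization of `congrNerve N`. -/
def congrNerve.normalizedAugmentation (N : ℕ) :
    ((normalizedMooreComplex _).obj (congrNerve N)).X 0 ⟶ ModuleCat.of ℤ (ZMod N) :=
  (NormalizedMooreComplex.objX (congrNerve N) 0).arrow ≫ augmentation N

lemma surjective_arrow_zero (S : SimplicialObject (ModuleCat.{0} ℤ)) :
    Function.Surjective (NormalizedMooreComplex.objX S 0).arrow :=
  have : IsIso (NormalizedMooreComplex.objX S 0).arrow :=
    inferInstanceAs (IsIso (⊤ : Subobject (S _⦋0⦌)).arrow)
  (ConcreteCategory.bijective_of_isIso _).2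

lemma congrNerve.d_normalizedAugmentation (N : ℕ) :
    ((normalizedMooreComplex _).obj (congrNerve N)).d 1 0 ≫ normalizedAugmentation N = 0 := by
  ext x
  have hx := (range_arrow_objX (congrNerve N) 0 _).1 ⟨x, rfl⟩ 0
  have h0 := congrFun (congrArg Subtype.val hx) 0
  refine (congrArg (augmentation N) (arrow_d (congrNerve N) 0 x)).trans ?_
  set y : (congrNerve N) _⦋1⦌ := (NormalizedMooreComplex.objX (congrNerve N) 1).arrow x
  have h1 := y.2 1 0
  replace h0 : y.1 0 = 0 := h0
  rw [h0, sub_zero] at h1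
  exact (ZMod.intCast_zmod_eq_zero_iff_dvd _ _).2 h1

lemma congrNerve.surjective_normalizedAugmentation (N : ℕ) :
    Function.Surjective (normalizedAugmentation N) := by
  intro z
  obtain ⟨k, rfl⟩ := ZMod.intCast_surjective z
  obtain ⟨x, hx⟩ := surjective_arrow_zero (congrNerve N) ⟨fun _ => k, by simp [congrTuples]⟩
  exact ⟨x, congrArg (augmentation N) hx⟩

lemma congrNerve.exists_d_eq (N : ℕ) (x : ((normalizedMooreComplex _).obj (congrNerve N)).X 0)
    (hx : normalizedAugmentation N x = 0) :
    ∃ y, ((normalizedMooreComplex _).obj (congrNerve N)).d 1 0 y = x := by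
  let m : (congrNerve N) _⦋0⦌ := (NormalizedMooreComplex.objX (congrNerve N) 0).arrow x
  have hm : (N : ℤ) ∣ m.1 0 := (ZMod.intCast_zmod_eq_zero_iff_dvd _ _).1 hx
  let y : (congrNerve N) _⦋1⦌ := ⟨![0, m.1 0], fun i j => by
    fin_cases i <;> fin_cases j <;> simp [hm]⟩
  obtain ⟨y', hy'⟩ := (range_arrow_objX (congrNerve N) 0 y).2 fun i => by
    obtain rfl : i = 0 := Fin.fin_one_eq_zero i
    exact Subtype.ext (funext fun j : Fin 1 => by obtain rfl := Fin.fin_one_eq_zero j; rfl)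
  refine ⟨y', injective_arrow _ _ ?_⟩
  refine (arrow_d (congrNerve N) 0 y').trans ((congrArg _ hy').trans ?_)
  exact Subtype.ext (funext fun j : Fin 1 => by obtain rfl := Fin.fin_one_eq_zero j; rfl)

/-- The projective resolution of `ℤ/N` given by the normalization of `congrNerve N`. -/
def congrNerve.resolution (N : ℕ) : ProjectiveResolution (ModuleCat.of ℤ (ZMod N)) where
  complex := (normalizedMooreComplex _).obj (congrNerve N)
  π := (ChainComplex.toSingle₀Equiv _ _).symm
    ⟨normalizedAugmentation N, d_normalizedAugmentation N⟩
  quasiIso := ⟨fun n => by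
    cases n with
    | zero =>
      rw [ChainComplex.quasiIsoAt₀_iff, ShortComplex.quasiIso_iff_of_zeros' _ _ rfl rfl]
      · refine (ShortComplex.exact_and_epi_g_iff_of_iso
          (S₂ := ShortComplex.mk _ _ (d_normalizedAugmentation N)) ?_).2
            ⟨(ShortComplex.moduleCat_exact_iff _).2 (exists_d_eq N),
              (ModuleCat.epi_iff_surjective _).2 (surjective_normalizedAugmentation N)⟩
        exact ShortComplex.isoMk (Iso.refl _) (Iso.refl _) (Iso.refl _)
          ((Category.id_comp _).trans (Category.comp_id _).symm)
          ((Category.id_comp _).trans (Category.comp_id _).symm)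
      · rfl
    | succ n =>
      rw [quasiIsoAt_iff_exactAt' _ _ (ChainComplex.exactAt_succ_single_obj _ _),
        HomologicalComplex.exactAt_iff_isZero_homology]
      obtain ⟨e⟩ := nonempty_homotopyGroup_linearEquiv (congrNerve N) n (Q := PUnit) 0
        (fun _ => ⟨0, by simp, rfl⟩) (fun x hx => by
          simp only [LinearMap.zero_apply, true_iff]
          exact ⟨0, by simp, by rw [congrNerve_eq_zero hx, map_zero]⟩)
      have : Subsingleton (((normalizedMooreComplex _).obj (congrNerve N)).homology (n + 1)) :=
        e.toEquiv.subsingleton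
      exact ModuleCat.isZero_of_subsingleton _⟩

end Resolution

/-! ### Coordinates on the tensor product of a module with its exterior square -/

section Coordinates

variable {R : Type*} [CommRing R] {A : Type*} [AddCommGroup A] [Module R A]
  {B : Type*} [AddCommGroup B] [Module R B]

/-- The linear form on `A ⊗ Λ²(A)` attached to three linear forms on `A`: it maps `a ⊗ (b ∧ c)` to
`ξ a * (η b * ζ c - η c * ζ b)`. -/
def coord (ξ η ζ : Module.Dual R A) : A ⊗[R] ⋀[R]^2 A →ₗ[R] R :=
  LinearMap.mul' R R ∘ₗ
    TensorProduct.map ξ (exteriorPower.pairingDual R A 2 (exteriorPower.ιMulti R 2 ![η, ζ]))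

@[simp]
lemma coord_tmul_ιMulti (ξ η ζ : Module.Dual R A) (a : A) (v : Fin 2 → A) :
    coord ξ η ζ (a ⊗ₜ exteriorPower.ιMulti R 2 v) =
      ξ a * (η (v 0) * ζ (v 1) - η (v 1) * ζ (v 0)) := by
  simp [coord, Matrix.det_fin_two]
  ring

/-- Linear maps on `A ⊗ Λᵏ(A)` are determined by their values on the elements
`a ⊗ (v₁ ∧ ⋯ ∧ vₖ)`. -/
lemma tensor_exteriorPower_ext {k : ℕ} {f g : A ⊗[R] ⋀[R]^k A →ₗ[R] B}
    (h : ∀ a v, f (a ⊗ₜ exteriorPower.ιMulti R k v) = g (a ⊗ₜ exteriorPower.ιMulti R k v)) :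
    f = g := by
  ext a v : 4
  exact h a v

variable (x : A ⊗[R] ⋀[R]^2 A) (ξ ξ' η η' ζ ζ' : Module.Dual R A) (r : R)

lemma coord_swap : coord ξ ζ η x = - coord ξ η ζ x := by
  suffices coord ξ ζ η = - coord ξ η ζ from LinearMap.congr_fun this x
  refine tensor_exteriorPower_ext fun a v => ?_
  simp; ring

lemma coord_self : coord ξ η η x = 0 := by
  suffices coord ξ η η = 0 from LinearMap.congr_fun this x
  refine tensor_exteriorPower_ext fun a v => ?_
  simp [mul_comm]

lemma coord_add₁ : coord (ξ + ξ') η ζ x = coord ξ η ζ x + coord ξ' η ζ x := by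
  suffices coord (ξ + ξ') η ζ = coord ξ η ζ + coord ξ' η ζ from LinearMap.congr_fun this x
  refine tensor_exteriorPower_ext fun a v => ?_
  simp; ring

lemma coord_add₂ : coord ξ (η + η') ζ x = coord ξ η ζ x + coord ξ η' ζ x := by
  suffices coord ξ (η + η') ζ = coord ξ η ζ + coord ξ η' ζ from LinearMap.congr_fun this x
  refine tensor_exteriorPower_ext fun a v => ?_
  simp; ring

lemma coord_smul₁ : coord (r • ξ) η ζ x = r * coord ξ η ζ x := by
  suffices coord (r • ξ) η ζ = r • coord ξ η ζ from LinearMap.congr_fun this x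
  refine tensor_exteriorPower_ext fun a v => ?_
  simp; ring

lemma coord_smul₂ : coord ξ (r • η) ζ x = r * coord ξ η ζ x := by
  suffices coord ξ (r • η) ζ = r • coord ξ η ζ from LinearMap.congr_fun this x
  refine tensor_exteriorPower_ext fun a v => ?_
  simp; ring

lemma coord_add₃ : coord ξ η (ζ + ζ') x = coord ξ η ζ x + coord ξ η ζ' x := by
  rw [coord_swap x ξ _ η, coord_add₂, coord_swap x ξ η ζ, coord_swap x ξ η ζ']
  ring

lemma coord_smul₃ : coord ξ η (r • ζ) x = r * coord ξ η ζ x := by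
  rw [coord_swap x ξ _ η, coord_smul₂, coord_swap x ξ η ζ]
  ring

lemma coord_sub₁ : coord (ξ - ξ') η ζ x = coord ξ η ζ x - coord ξ' η ζ x := by
  rw [sub_eq_add_neg, ← neg_one_smul R ξ', coord_add₁, coord_smul₁]; ring

lemma coord_sub₂ : coord ξ (η - η') ζ x = coord ξ η ζ x - coord ξ η' ζ x := by
  rw [sub_eq_add_neg, ← neg_one_smul R η', coord_add₂, coord_smul₂]; ring

lemma coord_sub₃ : coord ξ η (ζ - ζ') x = coord ξ η ζ x - coord ξ η ζ' x := by
  rw [sub_eq_add_neg, ← neg_one_smul R ζ', coord_add₃, coord_smul₃]; ring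

lemma coord_map (f : A →ₗ[R] B) (ξ η ζ : Module.Dual R B) :
    coord ξ η ζ (TensorProduct.map f (exteriorPower.map 2 f) x) =
      coord (ξ ∘ₗ f) (η ∘ₗ f) (ζ ∘ₗ f) x := by
  suffices coord ξ η ζ ∘ₗ TensorProduct.map f (exteriorPower.map 2 f) =
    coord (ξ ∘ₗ f) (η ∘ₗ f) (ζ ∘ₗ f) from LinearMap.congr_fun this x
  refine tensor_exteriorPower_ext fun a v => ?_
  simp

/-- The sum of the coordinates over the cyclic permutations of three linear forms factors through
the multiplication map, since the expansion of a determinant along a row computes `a ∧ b ∧ c`. -/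
lemma coord_cyclic {x : A ⊗[R] ⋀[R]^2 A} (hx : x ∈ LinearMap.ker (wedge R A 2)) :
    coord ξ η ζ x + coord η ζ ξ x + coord ζ ξ η x = 0 := by
  suffices coord ξ η ζ + coord η ζ ξ + coord ζ ξ η =
      exteriorPower.pairingDual R A 3 (exteriorPower.ιMulti R 3 ![ξ, η, ζ]) ∘ₗ wedge R A 2 by
    have h := LinearMap.congr_fun this x
    rw [LinearMap.mem_ker] at hx
    simpa [hx] using h
  refine tensor_exteriorPower_ext fun a v => ?_
  have h₁ : (Fin.cons a v : Fin 3 → A) 1 = v 0 := rfl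
  have h₂ : (Fin.cons a v : Fin 3 → A) 2 = v 1 := rfl
  simp [wedge_tmul_ιMulti, Matrix.det_fin_three, h₁, h₂]
  ring

/-- The linear forms `coord` on a basis separate the elements of `A ⊗ Λ²(A)`. -/
lemma eq_zero_of_coord_eq_zero {I : Type*} [LinearOrder I] (b : Module.Basis I R A)
    {x : A ⊗[R] ⋀[R]^2 A}
    (hx : ∀ i j k, coord (b.coord i) (b.coord j) (b.coord k) x = 0) : x = 0 := by
  rw [← (b.tensorProduct (b.exteriorPower 2)).repr.map_eq_zero_iff]
  ext ⟨i, s⟩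
  let e := Set.powersetCard.ofFinEmbEquiv.symm s
  have h : (b.tensorProduct (b.exteriorPower 2)).coord (i, s) =
      coord (b.coord i) (b.coord (e 0)) (b.coord (e 1)) := by
    refine tensor_exteriorPower_ext fun a v => ?_
    rw [Module.Basis.coord_apply, Module.Basis.tensorProduct_repr_tmul_apply,
      exteriorPower.basis_repr_apply, exteriorPower.ιMultiDual_apply_ιMulti, Matrix.det_fin_two]
    simp [e]
    ring
  exact (LinearMap.congr_fun h x).trans (hx _ _ _)

/-- The element `a ⊗ (a ∧ c)` of the kernel of the multiplication map. -/
def diagElt (a c : A) : LinearMap.ker (wedge R A 2) :=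
  ⟨a ⊗ₜ exteriorPower.ιMulti R 2 ![a, c], by
    rw [LinearMap.mem_ker, wedge_tmul_ιMulti]
    exact AlternatingMap.map_eq_zero_of_eq _ _ (i := 0) (j := 1) rfl (by decide)⟩

/-- The element `a ⊗ (b ∧ c) + b ⊗ (a ∧ c)` of the kernel of the multiplication map. -/
def symElt (a b c : A) : LinearMap.ker (wedge R A 2) :=
  ⟨a ⊗ₜ exteriorPower.ιMulti R 2 ![b, c] + b ⊗ₜ exteriorPower.ιMulti R 2 ![a, c], by
    rw [LinearMap.mem_ker, map_add, wedge_tmul_ιMulti, wedge_tmul_ιMulti]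
    have h : (Fin.cons b ![a, c] : Fin 3 → A) = Fin.cons a ![b, c] ∘ Equiv.swap 0 1 := by
      ext i; fin_cases i <;> rfl
    rw [h]
    exact AlternatingMap.map_add_swap _ _ (by decide)⟩

lemma coord_diagElt (a c : A) :
    coord ξ η ζ (diagElt (R := R) a c).1 = ξ a * (η a * ζ c - η c * ζ a) := by
  simp [diagElt]

lemma coord_symElt (a b c : A) :
    coord ξ η ζ (symElt (R := R) a b c).1 =
      ξ a * (η b * ζ c - η c * ζ b) + ξ b * (η a * ζ c - η c * ζ a) := by
  simp [symElt]

end Coordinates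

/-! ### Coordinates on the simplices of the model -/

namespace congrTuples

variable (N : ℕ) {ι κ : Type}

/-- The entry of a tuple at a given index, as a linear form. -/
def entry (i : ι) : Module.Dual ℤ (congrTuples N ι) :=
  LinearMap.proj i ∘ₗ (congrTuples N ι).subtype

/-- The linear form `m ↦ (m i - m j) / N`, where the division is exact. -/
def slope (i j : ι) : Module.Dual ℤ (congrTuples N ι) where
  toFun m := (m.1 i - m.1 j) / N
  map_add' m m' := by
    rw [← Int.add_ediv_of_dvd_left (m.2 i j)]
    congr 1
    simp only [Submodule.coe_add, Pi.add_apply]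
    ring
  map_smul' c m := by
    rw [RingHom.id_apply, smul_eq_mul, ← Int.mul_ediv_assoc _ (m.2 i j)]
    congr 1
    simp only [Submodule.coe_smul, Pi.smul_apply, smul_eq_mul]
    ring

lemma mul_slope (i j : ι) (m : congrTuples N ι) : N * slope N i j m = m.1 i - m.1 j :=
  Int.mul_ediv_cancel' (m.2 i j)

lemma entry_comp_reindex (f : κ → ι) (i : κ) :
    entry N i ∘ₗ reindex N f = entry N (f i) := rfl

lemma slope_comp_reindex (f : κ → ι) (i j : κ) :
    slope N i j ∘ₗ reindex N f = slope N (f i) (f j) := rfl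

lemma entry_eq_add (i j : ι) : entry N i = entry N j + (N : ℤ) • slope N i j := by
  ext m
  have := mul_slope N i j m
  simp only [entry, LinearMap.add_apply, LinearMap.smul_apply, smul_eq_mul, this]
  simp

lemma slope_eq_sub [NeZero N] (i j k : ι) : slope N i j = slope N i k - slope N j k := by
  ext m
  have hN : (N : ℤ) ≠ 0 := by exact_mod_cast NeZero.ne N
  refine mul_left_cancel₀ hN ?_
  rw [LinearMap.sub_apply, mul_sub, mul_slope, mul_slope, mul_slope]
  ring

/-- The linear forms dual to the basis of the module of tuples: the entry at `0` and the differences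
to it divided by `N`. -/
def form {n : ℕ} : Fin (n + 1) → Module.Dual ℤ (congrTuples N (Fin (n + 1))) :=
  Fin.cases (entry N 0) fun j => slope N j.succ 0

/-- The basis of the module of `(n + 1)`-tuples given by the constant tuple `1` and the tuples
`N • eⱼ` for `j ≠ 0`. -/
def basis [NeZero N] (n : ℕ) : Module.Basis (Fin (n + 1)) ℤ (congrTuples N (Fin (n + 1))) :=
  Module.Basis.ofEquivFun
    { LinearMap.pi (form N) with
      invFun c := ⟨fun i => c 0 + N * Fin.cases 0 (fun j => c j.succ) i, fun i j => by
        rw [add_sub_add_left_eq_sub, ← mul_sub]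
        exact dvd_mul_right _ _⟩
      left_inv m := by
        refine Subtype.ext (funext fun i => ?_)
        have h := mul_slope N i 0 m
        cases i using Fin.cases with
        | zero => simp [form, entry]
        | succ j => simp [form, entry, h]
      right_inv c := by
        have hN : (N : ℤ) ≠ 0 := by exact_mod_cast NeZero.ne N
        refine funext fun i => ?_
        cases i using Fin.cases with
        | zero => simp [form, entry]
        | succ j => simpa [form, slope] using Int.mul_ediv_cancel_left _ hN }

lemma basis_coord [NeZero N] (n : ℕ) (i : Fin (n + 1)) : (basis N n).coord i = form N i := by
  ext m
  simp [basis]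

lemma form_basis [NeZero N] {n : ℕ} (i j : Fin (n + 1)) :
    form N i (basis N n j) = if j = i then 1 else 0 := by
  rw [← basis_coord, Module.Basis.coord_apply, Module.Basis.repr_self, Finsupp.single_apply]

lemma form_comp_reindex_succ {n : ℕ} (k : Fin (n + 1)) (i : Fin (n + 1)) :
    form N i ∘ₗ reindex N k.succ.succAbove = form N (k.succ.succAbove i) := by
  cases i using Fin.cases with
  | zero => simp [form, entry_comp_reindex]
  | succ j =>
    cases n with
    | zero => exact j.elim0
    | succ n => simp [form, slope_comp_reindex]

lemma form_zero_comp_reindex_zero {n : ℕ} :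
    form N (0 : Fin (n + 1)) ∘ₗ reindex N (Fin.succAbove 0) = form N 0 + (N : ℤ) • form N 1 :=
  entry_eq_add N 1 0

lemma form_succ_comp_reindex_zero [NeZero N] {n : ℕ} (j : Fin n) :
    form N j.succ ∘ₗ reindex N (Fin.succAbove 0) = form N j.succ.succ - form N 1 :=
  slope_eq_sub N _ _ 0

end congrTuples

open congrTuples

/-- The simplicial abelian group obtained by applying `Y³` degreewise to `congrNerve 3`. -/
abbrev schurNerve : SimplicialObject (ModuleCat.{0} ℤ) :=
  ((SimplicialObject.whiskering _ _).obj (schurY ℤ 2)).obj (congrNerve 3)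

/-- A simplex of `schurNerve` as an element of `A ⊗ Λ²(A)`, where `A` is a module of tuples. -/
def schurNerveVal {n : ℕ} (x : schurNerve _⦋n⦌) :
    congrTuples 3 (Fin (n + 1)) ⊗[ℤ] ⋀[ℤ]^2 (congrTuples 3 (Fin (n + 1))) :=
  x.1

/-- The coordinates of the simplices of `schurNerve`. -/
def schurCoord {n : ℕ} (i j k : Fin (n + 1)) : schurNerve _⦋n⦌ →ₗ[ℤ] ℤ :=
  coord (form 3 i) (form 3 j) (form 3 k) ∘ₗ (LinearMap.ker (wedge ℤ (congrNerve 3 _⦋n⦌) 2)).subtype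

lemma schurCoord_eq {n : ℕ} (i j k : Fin (n + 1)) (x : schurNerve _⦋n⦌) :
    schurCoord i j k x = coord (form 3 i) (form 3 j) (form 3 k) (schurNerveVal x) := rfl

lemma schurCoord_swap {n : ℕ} (i j k : Fin (n + 1)) (x : schurNerve _⦋n⦌) :
    schurCoord i k j x = - schurCoord i j k x := coord_swap _ _ _ _

@[simp]
lemma schurCoord_self {n : ℕ} (i j : Fin (n + 1)) (x : schurNerve _⦋n⦌) :
    schurCoord i j j x = 0 := coord_self _ _ _

lemma schurCoord_cyclic {n : ℕ} (i j k : Fin (n + 1)) (x : schurNerve _⦋n⦌) :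
    schurCoord i j k x + schurCoord j k i x + schurCoord k i j x = 0 := coord_cyclic _ _ _ x.2

lemma schurNerve_eq_zero {n : ℕ} {x : schurNerve _⦋n⦌}
    (hx : ∀ i j k, j < k → schurCoord i j k x = 0) : x = 0 := by
  refine Subtype.ext (eq_zero_of_coord_eq_zero (basis 3 n) fun i j k => ?_)
  rw [basis_coord, basis_coord, basis_coord]
  change schurCoord i j k x = 0
  rcases lt_trichotomy j k with h | rfl | h
  · exact hx i j k h
  · exact schurCoord_self i j x
  · rw [schurCoord_swap, hx i k j h, neg_zero]

lemma schurCoord_δ {n : ℕ} (l : Fin (n + 2)) {i j k : Fin (n + 1)}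
    {α β γ : Module.Dual ℤ (congrTuples 3 (Fin (n + 2)))}
    (hα : form 3 i ∘ₗ reindex 3 l.succAbove = α) (hβ : form 3 j ∘ₗ reindex 3 l.succAbove = β)
    (hγ : form 3 k ∘ₗ reindex 3 l.succAbove = γ) (x : schurNerve _⦋n + 1⦌) :
    schurCoord i j k (schurNerve.δ l x) = coord α β γ (schurNerveVal x) := by
  subst hα hβ hγ
  exact coord_map _ _ _ _ _

lemma schurCoord_δ_succ {n : ℕ} (l : Fin (n + 1)) (i j k : Fin (n + 1)) (x : schurNerve _⦋n + 1⦌) :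
    schurCoord i j k (schurNerve.δ l.succ x) =
      schurCoord (l.succ.succAbove i) (l.succ.succAbove j) (l.succ.succAbove k) x :=
  schurCoord_δ _ (form_comp_reindex_succ 3 _ _) (form_comp_reindex_succ 3 _ _)
    (form_comp_reindex_succ 3 _ _) x

/-- A coordinate of a simplex in the normalized complex vanishes if its indices omit
a positive vertex. -/
lemma schurCoord_eq_zero {n : ℕ} {x : schurNerve _⦋n + 1⦌}
    (hx : ∀ l : Fin (n + 1), schurNerve.δ l.succ x = 0) {i j k : Fin (n + 2)}
    (h : ∃ l : Fin (n + 1), i ≠ l.succ ∧ j ≠ l.succ ∧ k ≠ l.succ) : schurCoord i j k x = 0 := by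
  obtain ⟨l, hi, hj, hk⟩ := h
  obtain ⟨i, rfl⟩ := Fin.exists_succAbove_eq hi
  obtain ⟨j, rfl⟩ := Fin.exists_succAbove_eq hj
  obtain ⟨k, rfl⟩ := Fin.exists_succAbove_eq hk
  rw [← schurCoord_δ_succ, hx, map_zero]

/-! ### Differentials of the normalized complex -/

section DegreeTwo

variable {x : schurNerve _⦋2⦌} (hx : ∀ l : Fin 2, schurNerve.δ l.succ x = 0)
include hx

lemma schurCoord_δ_zero_001 : schurCoord 0 0 1 (schurNerve.δ 0 x) =
    3 * schurCoord 0 1 2 x + 3 * schurCoord 1 0 2 x + 9 * schurCoord 1 1 2 x := by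
  have h₀ : form 3 (0 : Fin 2) ∘ₗ reindex 3 (Fin.succAbove 0) = form 3 0 + (3 : ℤ) • form 3 1 :=
    form_zero_comp_reindex_zero 3
  have h₁ : form 3 (1 : Fin 2) ∘ₗ reindex 3 (Fin.succAbove 0) = form 3 2 - form 3 1 :=
    form_succ_comp_reindex_zero 3 (0 : Fin 1)
  have e (i j k : Fin 3) (h : ∃ l : Fin 2, i ≠ l.succ ∧ j ≠ l.succ ∧ k ≠ l.succ) :
      schurCoord i j k x = 0 := schurCoord_eq_zero hx h
  rw [schurCoord_δ 0 h₀ h₀ h₁ x]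
  simp only [coord_add₁, coord_smul₁, coord_add₂, coord_smul₂, coord_sub₃,
    ← schurCoord_eq, schurCoord_self,
      e 0 0 1 (by decide), e 0 0 2 (by decide), e 1 0 1 (by decide)]
  ring

lemma schurCoord_δ_zero_101 : schurCoord 1 0 1 (schurNerve.δ 0 x) =
    schurCoord 0 1 2 x - 2 * schurCoord 1 0 2 x - 3 * schurCoord 1 1 2 x
      + 3 * schurCoord 2 1 2 x := by
  have h₀ : form 3 (0 : Fin 2) ∘ₗ reindex 3 (Fin.succAbove 0) = form 3 0 + (3 : ℤ) • form 3 1 :=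
    form_zero_comp_reindex_zero 3
  have h₁ : form 3 (1 : Fin 2) ∘ₗ reindex 3 (Fin.succAbove 0) = form 3 2 - form 3 1 :=
    form_succ_comp_reindex_zero 3 (0 : Fin 1)
  have e (i j k : Fin 3) (h : ∃ l : Fin 2, i ≠ l.succ ∧ j ≠ l.succ ∧ k ≠ l.succ) :
      schurCoord i j k x = 0 := schurCoord_eq_zero hx h
  rw [schurCoord_δ 0 h₁ h₀ h₁ x]
  simp only [coord_sub₁, coord_add₂, coord_smul₂, coord_sub₃,
    ← schurCoord_eq, schurCoord_self,
      e 1 0 1 (by decide), e 2 0 2 (by decide)]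
  have := schurCoord_cyclic 0 1 2 x
  have := schurCoord_swap 1 0 2 x
  have := schurCoord_swap 2 0 1 x
  lia

end DegreeTwo

section DegreeThree

variable {x : schurNerve _⦋3⦌} (hx : ∀ l : Fin 3, schurNerve.δ l.succ x = 0)
include hx

lemma schurCoord_δ_zero_012 : schurCoord 0 1 2 (schurNerve.δ 0 x) =
    3 * schurCoord 1 2 3 x := by
  have h₀ : form 3 (0 : Fin 3) ∘ₗ reindex 3 (Fin.succAbove 0) = form 3 0 + (3 : ℤ) • form 3 1 :=
    form_zero_comp_reindex_zero 3
  have h₁ : form 3 (1 : Fin 3) ∘ₗ reindex 3 (Fin.succAbove 0) = form 3 2 - form 3 1 :=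
    form_succ_comp_reindex_zero 3 (0 : Fin 2)
  have h₂ : form 3 (2 : Fin 3) ∘ₗ reindex 3 (Fin.succAbove 0) = form 3 3 - form 3 1 :=
    form_succ_comp_reindex_zero 3 (1 : Fin 2)
  have e (i j k : Fin 4) (h : ∃ l : Fin 3, i ≠ l.succ ∧ j ≠ l.succ ∧ k ≠ l.succ) :
      schurCoord i j k x = 0 := schurCoord_eq_zero hx h
  rw [schurCoord_δ 0 h₀ h₁ h₂ x]
  simp only [coord_add₁, coord_smul₁, coord_sub₂, coord_sub₃,
    ← schurCoord_eq, schurCoord_self,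
      e 0 1 3 (by decide), e 0 2 1 (by decide), e 0 2 3 (by decide), e 1 1 3 (by decide),
      e 1 2 1 (by decide)]
  ring

lemma schurCoord_δ_zero_102 : schurCoord 1 0 2 (schurNerve.δ 0 x) =
    3 * schurCoord 2 1 3 x := by
  have h₀ : form 3 (0 : Fin 3) ∘ₗ reindex 3 (Fin.succAbove 0) = form 3 0 + (3 : ℤ) • form 3 1 :=
    form_zero_comp_reindex_zero 3
  have h₁ : form 3 (1 : Fin 3) ∘ₗ reindex 3 (Fin.succAbove 0) = form 3 2 - form 3 1 :=
    form_succ_comp_reindex_zero 3 (0 : Fin 2)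
  have h₂ : form 3 (2 : Fin 3) ∘ₗ reindex 3 (Fin.succAbove 0) = form 3 3 - form 3 1 :=
    form_succ_comp_reindex_zero 3 (1 : Fin 2)
  have e (i j k : Fin 4) (h : ∃ l : Fin 3, i ≠ l.succ ∧ j ≠ l.succ ∧ k ≠ l.succ) :
      schurCoord i j k x = 0 := schurCoord_eq_zero hx h
  rw [schurCoord_δ 0 h₁ h₀ h₂ x]
  simp only [coord_sub₁, coord_add₂, coord_smul₂, coord_sub₃,
    ← schurCoord_eq, schurCoord_self,
      e 1 0 1 (by decide), e 1 0 3 (by decide), e 1 1 3 (by decide), e 2 0 1 (by decide),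
      e 2 0 3 (by decide)]
  ring

lemma schurCoord_δ_zero_112 : schurCoord 1 1 2 (schurNerve.δ 0 x) =
    - schurCoord 2 1 3 x - schurCoord 1 2 3 x := by
  have h₁ : form 3 (1 : Fin 3) ∘ₗ reindex 3 (Fin.succAbove 0) = form 3 2 - form 3 1 :=
    form_succ_comp_reindex_zero 3 (0 : Fin 2)
  have h₂ : form 3 (2 : Fin 3) ∘ₗ reindex 3 (Fin.succAbove 0) = form 3 3 - form 3 1 :=
    form_succ_comp_reindex_zero 3 (1 : Fin 2)
  have e (i j k : Fin 4) (h : ∃ l : Fin 3, i ≠ l.succ ∧ j ≠ l.succ ∧ k ≠ l.succ) :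
      schurCoord i j k x = 0 := schurCoord_eq_zero hx h
  rw [schurCoord_δ 0 h₁ h₁ h₂ x]
  simp only [coord_sub₁, coord_sub₂, coord_sub₃,
    ← schurCoord_eq, schurCoord_self,
      e 1 1 3 (by decide), e 1 2 1 (by decide), e 2 2 1 (by decide), e 2 2 3 (by decide)]
  have := schurCoord_cyclic 1 2 3 x
  have := schurCoord_swap 2 1 3 x
  have := schurCoord_swap 3 1 2 x
  lia

lemma schurCoord_δ_zero_212 : schurCoord 2 1 2 (schurNerve.δ 0 x) =
    schurCoord 2 1 3 x - 2 * schurCoord 1 2 3 x := by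
  have h₁ : form 3 (1 : Fin 3) ∘ₗ reindex 3 (Fin.succAbove 0) = form 3 2 - form 3 1 :=
    form_succ_comp_reindex_zero 3 (0 : Fin 2)
  have h₂ : form 3 (2 : Fin 3) ∘ₗ reindex 3 (Fin.succAbove 0) = form 3 3 - form 3 1 :=
    form_succ_comp_reindex_zero 3 (1 : Fin 2)
  have e (i j k : Fin 4) (h : ∃ l : Fin 3, i ≠ l.succ ∧ j ≠ l.succ ∧ k ≠ l.succ) :
      schurCoord i j k x = 0 := schurCoord_eq_zero hx h
  rw [schurCoord_δ 0 h₂ h₁ h₂ x]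
  simp only [coord_sub₁, coord_sub₂, coord_sub₃,
    ← schurCoord_eq, schurCoord_self,
      e 1 1 3 (by decide), e 1 2 1 (by decide), e 3 1 3 (by decide), e 3 2 3 (by decide)]
  have := schurCoord_cyclic 1 2 3 x
  have := schurCoord_swap 2 1 3 x
  have := schurCoord_swap 3 1 2 x
  lia

end DegreeThree

lemma schurNerve_zero_eq_zero (x : schurNerve _⦋0⦌) : x = 0 := by
  refine schurNerve_eq_zero fun i (j : Fin 1) (k : Fin 1) h => ?_
  lia

lemma schurNerve_one_eq_zero {x : schurNerve _⦋1⦌} (h₁ : schurCoord 0 0 1 x = 0)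
    (h₂ : schurCoord 1 0 1 x = 0) : x = 0 := by
  refine schurNerve_eq_zero fun i j k hjk => ?_
  have h : ∀ i j k : Fin 2, j < k → (i = 0 ∨ i = 1) ∧ j = 0 ∧ k = 1 := by decide
  obtain ⟨rfl | rfl, rfl, rfl⟩ := h i j k hjk
  · exact h₁
  · exact h₂

lemma schurNerve_two_eq_zero {x : schurNerve _⦋2⦌} (hx : ∀ l : Fin 2, schurNerve.δ l.succ x = 0)
    (h₁ : schurCoord 0 1 2 x = 0) (h₂ : schurCoord 1 0 2 x = 0)
    (h₃ : schurCoord 1 1 2 x = 0) (h₄ : schurCoord 2 1 2 x = 0) : x = 0 := by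
  have h₅ : schurCoord 2 0 1 x = 0 := by
    have := schurCoord_cyclic 0 1 2 x
    have := schurCoord_swap 1 0 2 x
    lia
  refine schurNerve_eq_zero fun i j k hjk => ?_
  by_cases hl : ∃ l : Fin 2, i ≠ l.succ ∧ j ≠ l.succ ∧ k ≠ l.succ
  · exact schurCoord_eq_zero hx hl
  have h : ∀ i j k : Fin 3, j < k → (¬ ∃ l : Fin 2, i ≠ l.succ ∧ j ≠ l.succ ∧ k ≠ l.succ) →
      (i = 0 ∧ j = 1 ∧ k = 2) ∨ (i = 1 ∧ j = 0 ∧ k = 2) ∨ (i = 1 ∧ j = 1 ∧ k = 2) ∨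
        (i = 2 ∧ j = 1 ∧ k = 2) ∨ (i = 2 ∧ j = 0 ∧ k = 1) := by decide
  obtain ⟨rfl, rfl, rfl⟩ | ⟨rfl, rfl, rfl⟩ | ⟨rfl, rfl, rfl⟩ | ⟨rfl, rfl, rfl⟩ | ⟨rfl, rfl, rfl⟩ :=
    h i j k hjk hl
  exacts [h₁, h₂, h₃, h₄, h₅]

lemma schurNerve_three_eq_zero {x : schurNerve _⦋3⦌} (hx : ∀ l : Fin 3, schurNerve.δ l.succ x = 0)
    (h₁ : schurCoord 1 2 3 x = 0) (h₂ : schurCoord 2 1 3 x = 0) : x = 0 := by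
  have h₃ : schurCoord 3 1 2 x = 0 := by
    have := schurCoord_cyclic 1 2 3 x
    have := schurCoord_swap 2 1 3 x
    lia
  refine schurNerve_eq_zero fun i j k hjk => ?_
  by_cases hl : ∃ l : Fin 3, i ≠ l.succ ∧ j ≠ l.succ ∧ k ≠ l.succ
  · exact schurCoord_eq_zero hx hl
  have h : ∀ i j k : Fin 4, j < k → (¬ ∃ l : Fin 3, i ≠ l.succ ∧ j ≠ l.succ ∧ k ≠ l.succ) →
      (i = 1 ∧ j = 2 ∧ k = 3) ∨ (i = 2 ∧ j = 1 ∧ k = 3) ∨ (i = 3 ∧ j = 1 ∧ k = 2) := by decide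
  obtain ⟨rfl, rfl, rfl⟩ | ⟨rfl, rfl, rfl⟩ | ⟨rfl, rfl, rfl⟩ := h i j k hjk hl
  exacts [h₁, h₂, h₃]

/-- Since `Y³` has degree three, the normalization of `schurNerve` vanishes from degree four on:
three indices cannot meet all positive vertices. -/
lemma schurNerve_add_four_eq_zero {n : ℕ} {x : schurNerve _⦋n + 4⦌}
    (hx : ∀ l : Fin (n + 4), schurNerve.δ l.succ x = 0) : x = 0 := by
  refine schurNerve_eq_zero fun i j k _ => schurCoord_eq_zero (n := n + 3) hx ?_
  by_contra! h
  have : (Finset.univ.image Fin.succ : Finset (Fin (n + 5))) ⊆ {i, j, k} := by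
    intro l hl
    obtain ⟨l, -, rfl⟩ := Finset.mem_image.1 hl
    have := h l
    simp only [Finset.mem_insert, Finset.mem_singleton]
    grind
  have := (Finset.card_le_card this).trans Finset.card_le_three
  rw [Finset.card_image_of_injective _ (Fin.succ_injective _), Finset.card_univ,
    Fintype.card_fin] at this
  lia

/-! ### Homology of the normalized complex -/

/-- The simplex `eₚ ⊗ (e_q ∧ eᵣ) + e_q ⊗ (eₚ ∧ eᵣ)` of `schurNerve`, where `e` is the basis of the
module of tuples. -/
def symSimplex {n : ℕ} (p q r : Fin (n + 1)) : schurNerve _⦋n⦌ :=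
  symElt (R := ℤ) (basis 3 n p) (basis 3 n q) (basis 3 n r)

/-- The simplex `eₚ ⊗ (eₚ ∧ eᵣ)` of `schurNerve`. -/
def diagSimplex {n : ℕ} (p r : Fin (n + 1)) : schurNerve _⦋n⦌ :=
  diagElt (R := ℤ) (basis 3 n p) (basis 3 n r)

lemma schurCoord_symSimplex {n : ℕ} (i j k p q r : Fin (n + 1)) :
    schurCoord i j k (symSimplex p q r) =
      (if p = i then 1 else 0) * ((if q = j then 1 else 0) * (if r = k then 1 else 0) -
          (if r = j then 1 else 0) * (if q = k then 1 else 0)) +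
        (if q = i then 1 else 0) * ((if p = j then 1 else 0) * (if r = k then 1 else 0) -
          (if r = j then 1 else 0) * (if p = k then 1 else 0)) := by
  refine (coord_symElt _ _ _ _ _ _).trans ?_
  simp only [form_basis]

lemma schurCoord_diagSimplex {n : ℕ} (i j k p r : Fin (n + 1)) :
    schurCoord i j k (diagSimplex p r) =
      (if p = i then 1 else 0) * ((if p = j then 1 else 0) * (if r = k then 1 else 0) -
          (if r = j then 1 else 0) * (if p = k then 1 else 0)) := by
  refine (coord_diagElt _ _ _ _ _).trans ?_
  simp only [form_basis]

lemma δ_succ_symSimplex_eq_zero {n : ℕ} (l : Fin (n + 1)) (p q r : Fin (n + 2))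
    (h : p = l.succ ∨ q = l.succ ∨ r = l.succ) :
    schurNerve.δ l.succ (symSimplex p q r) = 0 := by
  refine schurNerve_eq_zero fun i j k _ => ?_
  have hi := l.succ.succAbove_ne i
  have hj := l.succ.succAbove_ne j
  have hk := l.succ.succAbove_ne k
  rw [schurCoord_δ_succ, schurCoord_symSimplex]
  obtain rfl | rfl | rfl := h <;> simp [hi.symm, hj.symm, hk.symm]

lemma δ_succ_diagSimplex_eq_zero {n : ℕ} (l : Fin (n + 1)) (p r : Fin (n + 2))
    (h : p = l.succ ∨ r = l.succ) :
    schurNerve.δ l.succ (diagSimplex p r) = 0 := by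
  refine schurNerve_eq_zero fun i j k _ => ?_
  have hi := l.succ.succAbove_ne i
  have hj := l.succ.succAbove_ne j
  have hk := l.succ.succAbove_ne k
  rw [schurCoord_δ_succ, schurCoord_diagSimplex]
  obtain rfl | rfl := h <;> simp [hi.symm, hj.symm, hk.symm]

/-- The `0`-th face preserves the normalized complex. -/
lemma δ_succ_δ_zero_eq_zero {R : Type*} [Ring R] {S : SimplicialObject (ModuleCat R)} {n : ℕ}
    {y : S _⦋n + 2⦌} (hy : ∀ l : Fin (n + 2), S.δ l.succ y = 0) (l : Fin (n + 1)) :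
    S.δ l.succ (S.δ 0 y) = 0 := by
  have h := ConcreteCategory.congr_hom (S.δ_comp_δ (Fin.zero_le l.succ)) y
  refine h.symm.trans ?_
  exact (congrArg (S.δ 0) (hy l.succ)).trans (map_zero _)

/-- The class of a `1`-simplex with coordinates `p` at `(0, 0, 1)` and `q` at `(1, 0, 1)` is read
off by `p + 6 * q` modulo `9`. -/
lemma nonempty_homotopyGroup_one :
    Nonempty ((homotopyGroup schurNerve 1 : ModuleCat ℤ) ≃ₗ[ℤ] ZMod 9) := by
  have hδ (x : schurNerve _⦋1⦌) (i : Fin 2) : schurNerve.δ i x = 0 := schurNerve_zero_eq_zero _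
  refine nonempty_homotopyGroup_linearEquiv schurNerve 0
    ((Int.castAddHom (ZMod 9)).toIntLinearMap ∘ₗ
      (schurCoord 0 0 1 + (6 : ℤ) • schurCoord 1 0 1)) (fun q => ?_) fun x _ => ?_
  · obtain ⟨k, rfl⟩ := ZMod.intCast_surjective q
    refine ⟨k • diagSimplex 0 1, hδ _, ?_⟩
    simp [schurCoord_diagSimplex]
  · change ((schurCoord 0 0 1 x + 6 * schurCoord 1 0 1 x : ℤ) : ZMod 9) = 0 ↔ _
    rw [ZMod.intCast_zmod_eq_zero_iff_dvd]
    constructor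
    · rintro ⟨k, hk⟩
      -- The element with coordinates `(-q, -q, k, k)` has boundary `(9 * k - 6 * q, q)`.
      let y : schurNerve _⦋2⦌ := k • (diagSimplex 1 2 - diagSimplex 2 1) -
        schurCoord 1 0 1 x • symSimplex 0 1 2
      have hy (l : Fin 2) : schurNerve.δ l.succ y = 0 := by
        refine Submodule.sub_mem (LinearMap.ker (schurNerve.δ l.succ).hom)
          (Submodule.smul_mem _ _ (Submodule.sub_mem _ ?_ ?_)) (Submodule.smul_mem _ _ ?_)
        · exact δ_succ_diagSimplex_eq_zero _ _ _ (by decide +revert)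
        · exact δ_succ_diagSimplex_eq_zero _ _ _ (by decide +revert)
        · exact δ_succ_symSimplex_eq_zero _ _ _ _ (by decide +revert)
      refine ⟨y, hy, ?_⟩
      rw [← sub_eq_zero]
      refine schurNerve_one_eq_zero ?_ ?_
      · rw [map_sub, schurCoord_δ_zero_001 hy]
        simp [y, schurCoord_diagSimplex, schurCoord_symSimplex]
        lia
      · rw [map_sub, schurCoord_δ_zero_101 hy]
        simp [y, schurCoord_diagSimplex, schurCoord_symSimplex]
        lia
    · rintro ⟨y, hy, rfl⟩
      rw [schurCoord_δ_zero_001 hy, schurCoord_δ_zero_101 hy]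
      push_cast
      lia

/-- The class of a `2`-cycle is read off by its coordinate at `(0, 1, 2)` modulo `3`. -/
lemma nonempty_homotopyGroup_two :
    Nonempty ((homotopyGroup schurNerve 2 : ModuleCat ℤ) ≃ₗ[ℤ] ZMod 3) := by
  refine nonempty_homotopyGroup_linearEquiv schurNerve 1
    ((Int.castAddHom (ZMod 3)).toIntLinearMap ∘ₗ schurCoord 0 1 2) (fun q => ?_) fun x hx => ?_
  · obtain ⟨k, rfl⟩ := ZMod.intCast_surjective q
    -- The cycle with coordinates `(1, 2, -1, 0)`.
    let z : schurNerve _⦋2⦌ := symSimplex 0 1 2 - symSimplex 1 2 0 - diagSimplex 1 2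
    have hz (l : Fin 2) : schurNerve.δ l.succ z = 0 := by
      rw [map_sub, map_sub, δ_succ_diagSimplex_eq_zero _ _ _ (by decide +revert),
        δ_succ_symSimplex_eq_zero _ _ _ _ (by decide +revert),
        δ_succ_symSimplex_eq_zero _ _ _ _ (by decide +revert)]
      simp
    have hz₀ : schurNerve.δ 0 z = 0 := by
      refine schurNerve_one_eq_zero ?_ ?_
      · rw [schurCoord_δ_zero_001 hz]
        simp [z, schurCoord_diagSimplex, schurCoord_symSimplex]
      · rw [schurCoord_δ_zero_101 hz]
        simp [z, schurCoord_diagSimplex, schurCoord_symSimplex]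
    refine ⟨k • z, fun i => (map_smul _ _ _).trans ?_, ?_⟩
    · refine (congrArg _ (?_ : schurNerve.δ i z = 0)).trans (smul_zero k)
      cases i using Fin.cases with
      | zero => exact hz₀
      | succ l => exact hz l
    · simp [z, schurCoord_diagSimplex, schurCoord_symSimplex]
  · change ((schurCoord 0 1 2 x : ℤ) : ZMod 3) = 0 ↔ _
    have hx' (l : Fin 2) := hx l.succ
    have h₁ := schurCoord_δ_zero_001 hx'
    have h₂ := schurCoord_δ_zero_101 hx'
    rw [hx, map_zero] at h₁ h₂
    rw [ZMod.intCast_zmod_eq_zero_iff_dvd]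
    constructor
    · rintro ⟨k, hk⟩
      -- The simplex `y` has coordinates `u = k` and `v = -c - k`, as forced by the first and the
      -- third coordinate of the boundary, which have to be `3 * k` and `c`.
      let y : schurNerve _⦋3⦌ := k • symSimplex 1 2 3 +
        (schurCoord 1 1 2 x + 2 * k) • symSimplex 2 3 1
      have hy (l : Fin 3) : schurNerve.δ l.succ y = 0 := by
        refine Submodule.add_mem (LinearMap.ker (schurNerve.δ l.succ).hom)
          (Submodule.smul_mem _ _ ?_) (Submodule.smul_mem _ _ ?_) <;>
        exact δ_succ_symSimplex_eq_zero _ _ _ _ (by decide +revert)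
      refine ⟨y, hy, ?_⟩
      rw [← sub_eq_zero]
      refine schurNerve_two_eq_zero (fun l => ?_) ?_ ?_ ?_ ?_
      · rw [map_sub, hx, sub_zero]
        exact δ_succ_δ_zero_eq_zero hy l
      · rw [map_sub, schurCoord_δ_zero_012 hy]
        simp [y, schurCoord_symSimplex]
        lia
      · rw [map_sub, schurCoord_δ_zero_102 hy]
        simp [y, schurCoord_symSimplex]
        lia
      · rw [map_sub, schurCoord_δ_zero_112 hy]
        simp [y, schurCoord_symSimplex]
        lia
      · rw [map_sub, schurCoord_δ_zero_212 hy]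
        simp [y, schurCoord_symSimplex]
        lia
    · rintro ⟨y, hy, rfl⟩
      rw [schurCoord_δ_zero_012 hy]
      exact dvd_mul_right _ _

lemma subsingleton_homotopyGroup (i : ℕ) (h₁ : i ≠ 1) (h₂ : i ≠ 2) :
    Subsingleton (homotopyGroup schurNerve i : ModuleCat ℤ) := by
  match i, h₁, h₂ with
  | 0, _, _ =>
    let K := (normalizedMooreComplex (ModuleCat.{0} ℤ)).obj schurNerve
    have : Subsingleton (K.X 0) :=
      ⟨fun a b => injective_arrow schurNerve 0
        ((schurNerve_zero_eq_zero _).trans (schurNerve_zero_eq_zero _).symm)⟩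
    have h : IsZero (K.homology 0) := (K.exactAt_iff_isZero_homology 0).1
      (ShortComplex.exact_of_isZero_X₂ _ (ModuleCat.isZero_of_subsingleton (K.X 0)))
    exact ModuleCat.subsingleton_of_isZero h
  | n + 3, _, _ =>
    obtain ⟨e⟩ := nonempty_homotopyGroup_linearEquiv schurNerve (n + 2) (Q := PUnit) 0
      (fun _ => ⟨0, by simp, rfl⟩) (fun x hx => by
        simp only [LinearMap.zero_apply, true_iff]
        refine ⟨0, by simp, ?_⟩
        rw [map_zero]
        refine Eq.symm ?_
        match n, x, hx with
        | 0, x, hx =>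
          have hx' (l : Fin 3) := hx l.succ
          have h₁ := schurCoord_δ_zero_012 hx'
          have h₂ := schurCoord_δ_zero_102 hx'
          rw [hx, map_zero] at h₁ h₂
          exact schurNerve_three_eq_zero hx' (by lia) (by lia)
        | n + 1, x, hx => exact schurNerve_add_four_eq_zero fun l => hx l.succ)
    exact e.toEquiv.subsingleton

end DoldPuppe
end

theorem mainTheorem12
    (P : ProjectiveResolution (ModuleCat.of ℤ (ZMod 3))) :
    Nonempty ((DoldPuppe.derivedFunctor (DoldPuppe.schurY ℤ 2) P 2 : ModuleCat ℤ) ≃+ ZMod 3) ∧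
      Nonempty ((DoldPuppe.derivedFunctor (DoldPuppe.schurY ℤ 2) P 1 : ModuleCat ℤ) ≃+ ZMod 9) ∧
      ∀ i : ℕ, i ≠ 1 → i ≠ 2 →
        Subsingleton (DoldPuppe.derivedFunctor (DoldPuppe.schurY ℤ 2) P i : ModuleCat ℤ) := by
  have e (i : ℕ) : Nonempty
      ((DoldPuppe.derivedFunctor (DoldPuppe.schurY ℤ 2) P i : ModuleCat ℤ) ≃ₗ[ℤ]
      (DoldPuppe.homotopyGroup DoldPuppe.schurNerve i : ModuleCat ℤ)) := by
    obtain ⟨e⟩ := DoldPuppe.nonempty_derivedFunctor_iso (DoldPuppe.schurY ℤ 2) P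
      (DoldPuppe.congrNerve.resolution 3) (X := DoldPuppe.congrNerve 3) (Iso.refl _) i
    exact ⟨e.toLinearEquiv⟩
  refine ⟨?_, ?_, fun i h₁ h₂ => ?_⟩
  · obtain ⟨e⟩ := e 2
    obtain ⟨e'⟩ := DoldPuppe.nonempty_homotopyGroup_two
    exact ⟨(e.trans e').toAddEquiv⟩
  · obtain ⟨e⟩ := e 1
    obtain ⟨e'⟩ := DoldPuppe.nonempty_homotopyGroup_one
    exact ⟨(e.trans e').toAddEquiv⟩
  · obtain ⟨e⟩ := e i
    have := DoldPuppe.subsingleton_homotopyGroup i h₁ h₂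
    exact e.toEquiv.subsingleton
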